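/- **Theorem 1.1.** Let $n\ge 3$, let $H=\langle a,b\mid a^n=b^2=1,\ bab=a^{-1}\rangle$ be the dihedral group of order $2n$, and let $S\subseteq H\setminus\{1\}$ with $S=S^{-1}$. Let $\Sigma=\mathrm{Cay}(H,S)$ be the Cayley graph with vertex set $H$ and edge set $\{\{g,sg\}\mid g\in H,\ s\in S\}$, and suppose that $\Sigma$ is connected and trivalent (every vertex has exactly three neighbours). Suppose that $\Sigma$ is not arc-transitive (that is, $\mathrm{Aut}(\Sigma)$ is not transitive on the ordered pairs of adjacent vertices) and not normal (that is, the group $R(H)=\{x\mapsto xg\mid g\in H\}$ of right translations is not normal in $\mathrm{Aut}(\Sigma)$). Then $n$ is even, $\Sigma$ is isomorphic to the cross ladder graph $\mathrm{CL}_{4m}$ with $m=\frac n2$, and $S^\alpha=\{b,\,ba,\,ba^{n/2}\}$ for some $\alpha\in\mathrm{Aut}(H)$. Here, for $m\ge 2$, the cross ladder graph $\mathrm{CL}_{4m}$ has the $4m$ vertices $x_j^r$ ($j\in\mathbb Z_{2m}$, $r\in\mathbb Z_2$) and the edges $\{x_{2i}^r,x_{2i+1}^r\}$ and $\{x_{2i+1}^r,x_{2i+2}^s\}$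 for $i\in\mathbb Z_m$ and $r,s\in\mathbb Z_2$. -/

import Mathlib

namespace Dihedrant

/-- The Cayley graph `Cay(G, S)`: the vertices are the elements of `G` and the edges are the
pairs `{g, s * g}` with `g ∈ G` and `s ∈ S`. (It is used for `S` inverse-closed with `1 ∉ S`.) -/
def cay {G : Type*} [Group G] (S : Set G) : SimpleGraph G :=
  SimpleGraph.fromRel fun g h => ∃ s ∈ S, h = s * g

/-- The right translation `R(g) : x ↦ x * g`, as an automorphism of `Cay(G, S)`. -/
def rightTranslation {G : Type*} [Group G] (S : Set G) (g : G) : cay S ≃g cay S where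
  toEquiv := Equiv.mulRight g
  map_rel_iff' := by
    intro x y
    simp [cay, ← mul_assoc]

/-- `R(G) = {R(g) | g ∈ G}`, as a subgroup of the automorphism group of `Cay(G, S)`. -/
def rightRegular {G : Type*} [Group G] (S : Set G) : Subgroup (cay S ≃g cay S) where
  carrier := Set.range (rightTranslation S)
  mul_mem' := by
    rintro _ _ ⟨g, rfl⟩ ⟨h, rfl⟩
    refine ⟨h * g, RelIso.ext fun x => ?_⟩
    exact (mul_assoc x h g).symm
  one_mem' := ⟨1, RelIso.ext fun x => mul_one x⟩
  inv_mem' := by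
    rintro _ ⟨g, rfl⟩
    exact ⟨g⁻¹, RelIso.ext fun x => rfl⟩

/-- `Cay(G, S)` is a normal Cayley graph: `R(G)` is normal in the full automorphism group. -/
def IsNormalCayley {G : Type*} [Group G] (S : Set G) : Prop :=
  (rightRegular S).Normal

/-- Every vertex has exactly three neighbours. -/
def IsTrivalent {V : Type*} (Γ : SimpleGraph V) : Prop :=
  ∀ v, (Γ.neighborSet v).ncard = 3

/-- The full automorphism group is transitive on arcs, i.e. on ordered pairs of adjacent
vertices. -/
def IsArcTransitive {V : Type*} (Γ : SimpleGraph V) : Prop :=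
  ∀ u v u' v' : V, Γ.Adj u v → Γ.Adj u' v' → ∃ φ : Γ ≃g Γ, φ u = u' ∧ φ v = v'

/-- The cross ladder graph of order `4 * m` (for `m ≥ 2`): the vertex `x_j ^ r` is `(j, r)`, with
`j` modulo `2 * m` and `r` modulo `2`; the edges are `{x_{2i} ^ r, x_{2i+1} ^ r}` and
`{x_{2i+1} ^ r, x_{2i+2} ^ s}`. As `i` runs through `ZMod (2 * m)`, `2 * i` runs through the even
residues modulo `2 * m`. -/
def crossLadder (m : ℕ) : SimpleGraph (ZMod (2 * m) × ZMod 2) :=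
  SimpleGraph.fromEdgeSet
    ({e | ∃ (i : ZMod (2 * m)) (r : ZMod 2), e = s((2 * i, r), (2 * i + 1, r))} ∪
     {e | ∃ (i : ZMod (2 * m)) (r s : ZMod 2), e = s((2 * i + 1, r), (2 * i + 2, s))})

/-- The rotation `a` of order `n` in the dihedral group of order `2 * n`. -/
def a (n : ℕ) : DihedralGroup n := DihedralGroup.r 1

/-- The reflection `b`, so that `a ^ n = b ^ 2 = 1` and `b * a * b = a⁻¹`. -/
def b (n : ℕ) : DihedralGroup n := DihedralGroup.sr 0

end Dihedrant

namespace Dihedrant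

/-! ### Rigid generators and normality of a trivalent Cayley graph -/

section Group

variable {G : Type*} [Group G] {S : Set G}

/-! The stabilizer of the vertex 1 is not transitive on the three elements of S, so it fixes some s
(`exists_isRigid`); left multiplication by s then commutes with every automorphism. If the
stabilizer acted faithfully on S = {s, x, y}, it would have order at most 2 and R(H) would be
normal. Hence s is an involution, and some σ fixes all neighbours of a vertex v but not all those of
s v (`exists_fixesBall`).

Pointwise fixed balls propagate along x and y. Comparing the vertices s t' v, which σ fixes, with
the vertices t s v, which it moves, excludes rotations from S, and the image under σ of an edge near
s v forces x y = y x (`exists_eq_sr`).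

Two distinct commuting reflections have indices differing by n/2, so n is even. Connectedness makes
a suitable difference of indices a unit, an affine automorphism normalizes S
(`exists_mulAut_image`), and `toLadder` identifies the normalized graph with the ladder. -/

theorem cay_adj_iff (h1 : (1 : G) ∉ S) (hinv : ∀ s ∈ S, s⁻¹ ∈ S) {g h : G} :
    (cay S).Adj g h ↔ ∃ s ∈ S, h = s * g := by
  simp only [cay, SimpleGraph.fromRel_adj]
  constructor
  · rintro ⟨-, h | ⟨s, hs, rfl⟩⟩
    · exact h
    · exact ⟨s⁻¹, hinv s hs, by simp⟩
  · rintro ⟨s, hs, rfl⟩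
    refine ⟨fun h => h1 ?_, Or.inl ⟨s, hs, rfl⟩⟩
    have : s = 1 := by simpa using h.symm
    exact this ▸ hs

@[simp]
theorem rightTranslation_apply (g x : G) : rightTranslation S g x = x * g := rfl

theorem cay_adj_mul_left (h1 : (1 : G) ∉ S) (hinv : ∀ s ∈ S, s⁻¹ ∈ S) {s : G} (hs : s ∈ S)
    (g : G) : (cay S).Adj g (s * g) :=
  (cay_adj_iff h1 hinv).2 ⟨s, hs, rfl⟩

theorem exists_map_mul_left (h1 : (1 : G) ∉ S) (hinv : ∀ s ∈ S, s⁻¹ ∈ S)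
    (σ : cay S ≃g cay S) {s : G} (hs : s ∈ S) (g : G) : ∃ t ∈ S, σ (s * g) = t * σ g :=
  (cay_adj_iff h1 hinv).1 (σ.map_rel_iff.2 (cay_adj_mul_left h1 hinv hs g))

theorem map_mem_of_map_one (h1 : (1 : G) ∉ S) (hinv : ∀ s ∈ S, s⁻¹ ∈ S)
    {σ : cay S ≃g cay S} (hσ : σ 1 = 1) {s : G} (hs : s ∈ S) : σ s ∈ S := by
  obtain ⟨t, ht, h⟩ := exists_map_mul_left h1 hinv σ hs 1
  rw [mul_one, hσ, mul_one] at h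
  exact h ▸ ht

/-- Every vertex property inherited along edges holds on a connected Cayley graph as soon as it
holds at one vertex. -/
theorem forall_of_connected (h1 : (1 : G) ∉ S) (hinv : ∀ s ∈ S, s⁻¹ ∈ S)
    (hconn : (cay S).Connected) {P : G → Prop} {g₀ : G} (h0 : P g₀)
    (hstep : ∀ s ∈ S, ∀ g, P g → P (s * g)) (g : G) : P g := by
  obtain ⟨w⟩ := hconn.preconnected g₀ g
  induction w with
  | nil => exact h0
  | cons hadj _ ih =>
    obtain ⟨s, hs, rfl⟩ := (cay_adj_iff h1 hinv).1 hadj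
    exact ih (hstep s hs _ h0)

/-- An element of `S` fixed by the stabilizer of the identity in `Aut (Cay(G, S))`. -/
def IsRigid (S : Set G) (s : G) : Prop :=
  ∀ σ : cay S ≃g cay S, σ 1 = 1 → σ s = s

/-- The automorphism x ↦ σ (x g) (σ g)⁻¹ fixes 1, hence fixes s. -/
theorem IsRigid.map_mul {s : G} (hs : IsRigid S s) (σ : cay S ≃g cay S) (g : G) :
    σ (s * g) = s * σ g := by
  have h := hs (((rightTranslation S g).trans σ).trans (rightTranslation S (σ g)⁻¹)) (by simp)
  simpa [mul_inv_eq_iff_eq_mul] using h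

theorem IsRigid.inv {s : G} (hs : IsRigid S s) : IsRigid S s⁻¹ := by
  intro σ hσ
  have h := hs.map_mul σ s⁻¹
  rw [mul_inv_cancel, hσ] at h
  exact (inv_eq_of_mul_eq_one_right h.symm).symm

theorem exists_map_ne_of_not_isArcTransitive (h1 : (1 : G) ∉ S) (hinv : ∀ s ∈ S, s⁻¹ ∈ S)
    (harc : ¬ IsArcTransitive (cay S)) :
    ∃ s ∈ S, ∃ t ∈ S, ∀ σ : cay S ≃g cay S, σ 1 = 1 → σ s ≠ t := by
  by_contra! h
  refine harc fun u v u' v' huv huv' => ?_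
  obtain ⟨s, hs, rfl⟩ := (cay_adj_iff h1 hinv).1 huv
  obtain ⟨t, ht, rfl⟩ := (cay_adj_iff h1 hinv).1 huv'
  obtain ⟨σ, hσ, hst⟩ := h s hs t ht
  exact ⟨((rightTranslation S u⁻¹).trans σ).trans (rightTranslation S u'),
    by simp [hσ], by simp [hst]⟩

/-- A group acting intransitively on three points fixes one of them. -/
theorem exists_isRigid (h1 : (1 : G) ∉ S) (hinv : ∀ s ∈ S, s⁻¹ ∈ S) (hcard : S.ncard = 3)
    (harc : ¬ IsArcTransitive (cay S)) :
    ∃ s x y, S = {s, x, y} ∧ s ≠ x ∧ s ≠ y ∧ x ≠ y ∧ IsRigid S s := by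
  suffices ∃ s ∈ S, IsRigid S s by
    obtain ⟨s, hs, hr⟩ := this
    obtain ⟨p, q, t, hpq, hpt, hqt, hS⟩ := Set.ncard_eq_three.1 hcard
    rw [hS] at hs
    rcases hs with rfl | rfl | rfl
    · exact ⟨s, q, t, hS, hpq, hpt, hqt, hr⟩
    · exact ⟨s, p, t, by rw [hS, Set.insert_comm], hpq.symm, hqt, hpt, hr⟩
    · refine ⟨s, p, q, ?_, hpt.symm, hqt.symm, hpq, hr⟩
      rw [hS, Set.pair_comm, Set.insert_comm]
  obtain ⟨s, hs, t, ht, hst⟩ := exists_map_ne_of_not_isArcTransitive h1 hinv harc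
  by_contra! hnot
  have hs' := hnot s hs
  have ht' := hnot t ht
  simp only [IsRigid, not_forall] at hs' ht'
  obtain ⟨σ, hσ, hσs⟩ := hs'
  obtain ⟨τ, hτ, hτt⟩ := ht'
  have hne : s ≠ t := hst (RelIso.refl _) rfl
  have hσt : σ s ≠ t := hst σ hσ
  have hτ1 : τ.symm 1 = 1 := by
    conv_lhs => rw [← hτ]
    simp
  have hτs : τ t ≠ s := fun h => hst τ.symm hτ1 (by rw [← h]; simp)
  have hmem : ({s, t, σ s, τ t} : Set G) ⊆ S := by
    rintro _ (rfl | rfl | rfl | rfl)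
    exacts [hs, ht, map_mem_of_map_one h1 hinv hσ hs, map_mem_of_map_one h1 hinv hτ ht]
  -- If the two images agree, τ⁻¹ σ carries s to t; otherwise S has four elements.
  by_cases heq : σ s = τ t
  · exact hst (σ.trans τ.symm) (by simp [hσ, hτ1]) (by simp [heq])
  · have hfin : S.Finite := Set.finite_of_ncard_ne_zero (by omega)
    have h4 : ({s, t, σ s, τ t} : Set G).ncard = 4 := by
      classical
      rw [Set.ncard_eq_toFinset_card']
      simp only [Set.toFinset_insert, Set.toFinset_singleton]
      rw [Finset.card_insert_of_notMem, Finset.card_insert_of_notMem, Finset.card_pair heq]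
      · simpa using ⟨hσt.symm, Ne.symm hτt⟩
      · simpa using ⟨hne, Ne.symm hσs, hτs.symm⟩
    have := Set.ncard_le_ncard hmem hfin
    omega

/-- If an automorphism fixing the identity and `S` pointwise is trivial, and the stabilizer of the
identity fixes one of the three elements of `S`, then `Cay(G, S)` is normal. -/
theorem isNormalCayley_of_forall_eq_one (h1 : (1 : G) ∉ S) (hinv : ∀ s ∈ S, s⁻¹ ∈ S) {s x y : G}
    (hS : S = {s, x, y}) (hsx : s ≠ x) (hsy : s ≠ y) (hxy : x ≠ y) (hr : IsRigid S s)
    (hfaith : ∀ σ : cay S ≃g cay S, σ 1 = 1 → σ x = x → σ y = y → σ = 1) :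
    IsNormalCayley S := by
  have hmem : ∀ {τ : cay S ≃g cay S}, τ 1 = 1 → ∀ {z}, z ∈ S → z ≠ s → τ z = x ∨ τ z = y := by
    intro τ hτ z hz hzs
    have h := map_mem_of_map_one h1 hinv hτ hz
    replace h : τ z ∈ ({s, x, y} : Set G) := hS.subset h
    rcases h with h | h | h
    · exact absurd (τ.injective (h.trans (hr τ hτ).symm)) hzs
    · exact Or.inl h
    · exact Or.inr h
  have hxS : x ∈ S := by simp [hS]
  have hyS : y ∈ S := by simp [hS]
  have hdich : ∀ {τ : cay S ≃g cay S}, τ 1 = 1 → τ = 1 ∨ (τ x = y ∧ τ y = x) := by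
    intro τ hτ
    rcases hmem hτ hxS hsx.symm with hx | hx
    · rcases hmem hτ hyS hsy.symm with hy | hy
      · exact absurd (τ.injective (hx.trans hy.symm)) hxy
      · exact Or.inl (hfaith τ hτ hx hy)
    · rcases hmem hτ hyS hsy.symm with hy | hy
      · exact Or.inr ⟨hx, hy⟩
      · exact absurd (τ.injective (hx.trans hy.symm)) hxy
  have hR : ∀ g, rightTranslation S g ∈ rightRegular S := fun g => ⟨g, rfl⟩
  have hstab : ∀ τ : cay S ≃g cay S, τ 1 = 1 → ∀ ρ ∈ rightRegular S,
      τ * ρ * τ⁻¹ ∈ rightRegular S := by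
    intro τ hτ ρ hρ
    set μ := τ * ρ * τ⁻¹ with hμ
    set ν := (rightTranslation S (μ 1))⁻¹ * μ with hν
    have hμν : μ = rightTranslation S (μ 1) * ν := by rw [hν, mul_inv_cancel_left]
    have hν1 : ν 1 = 1 := by
      apply (rightTranslation S (μ 1)).injective
      have := congrArg (fun f : cay S ≃g cay S => f 1) hμν
      simpa [RelIso.mul_apply] using this.symm
    rcases hdich hν1 with hν' | ⟨hνx, hνy⟩
    · rw [hμν, hν', mul_one]
      exact hR _
    rcases hdich hτ with hτ' | ⟨hτx, hτy⟩
    · rw [hμ, hτ']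
      simpa using hρ
    -- Both factors interchange x and y, so the product fixes S pointwise.
    have hprod : ν * τ = 1 :=
      hfaith _ (by simp [RelIso.mul_apply, hτ, hν1]) (by simp [RelIso.mul_apply, hτx, hνy])
        (by simp [RelIso.mul_apply, hτy, hνx])
    have h2 : τ * ρ = rightTranslation S (μ 1) := by
      calc τ * ρ = μ * τ := by rw [hμ]; group
        _ = rightTranslation S (μ 1) * (ν * τ) := by rw [← mul_assoc, ← hμν]
        _ = _ := by rw [hprod, mul_one]
    have hτR : τ ∈ rightRegular S := by
      have := (rightRegular S).mul_mem (hR (μ 1)) ((rightRegular S).inv_mem hρ)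
      rwa [← h2, mul_inv_cancel_right] at this
    exact (rightRegular S).mul_mem ((rightRegular S).mul_mem hτR hρ)
      ((rightRegular S).inv_mem hτR)
  refine ⟨fun ρ hρ σ => ?_⟩
  set τ := (rightTranslation S (σ 1))⁻¹ * σ with hτ
  have hσ : σ = rightTranslation S (σ 1) * τ := by rw [hτ, mul_inv_cancel_left]
  have hτ1 : τ 1 = 1 := by
    apply (rightTranslation S (σ 1)).injective
    have := congrArg (fun f : cay S ≃g cay S => f 1) hσ
    simpa [RelIso.mul_apply] using this.symm
  have := (rightRegular S).mul_mem ((rightRegular S).mul_mem (hR (σ 1)) (hstab τ hτ1 ρ hρ))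
    ((rightRegular S).inv_mem (hR (σ 1)))
  convert this using 1
  conv_lhs => rw [hσ]
  group

/-- The automorphism `σ` fixes the vertex `v` and all its neighbours. -/
def FixesBall (σ : cay S ≃g cay S) (v : G) : Prop :=
  σ v = v ∧ ∀ t ∈ S, σ (t * v) = t * v

/-- If two of the three neighbours of a fixed vertex are fixed, then so is the third. -/
theorem fixesBall_of_two (h1 : (1 : G) ∉ S) (hinv : ∀ s ∈ S, s⁻¹ ∈ S) {s x y : G}
    (hS : S = {s, x, y}) {σ : cay S ≃g cay S} {v : G} (hv : σ v = v) {p q : G} (hp : p ∈ S)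
    (hq : q ∈ S) (hpq : p ≠ q) (hσp : σ (p * v) = p * v) (hσq : σ (q * v) = q * v) :
    FixesBall σ v := by
  refine ⟨hv, fun t ht => ?_⟩
  obtain ⟨t', ht', h⟩ := exists_map_mul_left h1 hinv σ ht v
  rw [hv] at h
  by_cases htp : t = p
  · rw [htp, hσp]
  by_cases htq : t = q
  · rw [htq, hσq]
  have h1' : t' ≠ p := by
    rintro rfl
    exact htp (mul_right_cancel (σ.injective (h.trans hσp.symm)))
  have h2' : t' ≠ q := by
    rintro rfl
    exact htq (mul_right_cancel (σ.injective (h.trans hσq.symm)))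
  have : t' = t := by
    rw [hS] at ht ht' hp hq
    simp only [Set.mem_insert_iff, Set.mem_singleton_iff] at ht ht' hp hq
    grind
  rw [h, this]

/-- The vertex t v has two fixed neighbours: s t v by rigidity, and v itself. They are distinct
because s is an involution and t ≠ s. -/
theorem FixesBall.mul {s x y : G} (h1 : (1 : G) ∉ S) (hinv : ∀ s ∈ S, s⁻¹ ∈ S)
    (hS : S = {s, x, y}) (hr : IsRigid S s) (hs : s⁻¹ = s) {σ : cay S ≃g cay S} {v t : G}
    (h : FixesBall σ v) (ht : t ∈ S) (hts : t ≠ s) : FixesBall σ (t * v) := by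
  have hv := h.2 t ht
  refine fixesBall_of_two h1 hinv hS hv (p := s) (q := t⁻¹) (by simp [hS]) (hinv t ht) ?_ ?_ ?_
  · intro h
    exact hts (by rw [← hs, h, inv_inv])
  · rw [hr.map_mul, hv]
  · rw [inv_mul_cancel_left, h.1]

/-- A non-normal Cayley graph of valency three with a rigid element `s` of `S` has a nontrivial
automorphism fixing all neighbours of some vertex `v`, but not those of `s * v`. -/
theorem exists_fixesBall (h1 : (1 : G) ∉ S) (hinv : ∀ s ∈ S, s⁻¹ ∈ S)
    (hconn : (cay S).Connected) {s x y : G}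
    (hS : S = {s, x, y}) (hsx : s ≠ x) (hsy : s ≠ y) (hxy : x ≠ y) (hr : IsRigid S s)
    (hnormal : ¬ IsNormalCayley S) :
    s⁻¹ = s ∧ ∃ (σ : cay S ≃g cay S) (v : G), FixesBall σ v ∧ ¬ FixesBall σ (s * v) := by
  have hsS : s ∈ S := by simp [hS]
  have hnot : ∃ σ : cay S ≃g cay S, FixesBall σ 1 ∧ ∃ t ∈ S, ∃ v,
      FixesBall σ v ∧ ¬ FixesBall σ (t * v) := by
    by_contra! h
    refine hnormal (isNormalCayley_of_forall_eq_one h1 hinv hS hsx hsy hxy hr ?_)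
    intro σ hσ hx hy
    have h0 : FixesBall σ 1 :=
      fixesBall_of_two h1 hinv hS hσ (p := x) (q := y) (by simp [hS]) (by simp [hS]) hxy
        (by simpa using hx) (by simpa using hy)
    refine RelIso.ext fun g => ?_
    exact (forall_of_connected h1 hinv hconn h0 (fun t ht v hv => h σ h0 t ht v hv) g).1
  obtain ⟨σ, -, t, ht, v, hv, htv⟩ := hnot
  -- Otherwise s and s⁻¹ are two distinct rigid generators, and fixed balls would propagate along
  -- every edge.
  have hs : s⁻¹ = s := by
    by_contra hs
    have htv' := hv.2 t ht
    exact htv (fixesBall_of_two h1 hinv hS htv' (p := s⁻¹) (q := s) (hinv s hsS) hsS hs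
      (by rw [hr.inv.map_mul, htv']) (by rw [hr.map_mul, htv']))
  refine ⟨hs, σ, v, hv, ?_⟩
  by_cases hts : t = s
  · rwa [← hts]
  · exact absurd (hv.mul h1 hinv hS hr hs ht hts) htv

end Group

open DihedralGroup

/-! ### The connection set consists of reflections -/

section Stabilizer

variable {n : ℕ} {S : Set (DihedralGroup n)}

/-- If `x` and `y` are commuting reflections of the dihedral group, their indices differ by an
element of order at most two. -/
theorem two_mul_sub_eq_zero_of_commute {i j : ZMod n} (h : sr j * sr i = sr i * sr j) :
    2 * (j - i) = 0 := by
  simp only [sr_mul_sr, r.injEq] at h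
  linear_combination -h

theorem r_mul_sr_eq_sr_mul_inv (k c : ZMod n) : r k * sr c = sr c * (r k)⁻¹ := by
  simp [sub_eq_add_neg]

theorem sr_mul_sr_mul_sr_comm (i j c : ZMod n) : sr j * (sr i * sr c) = sr c * (sr i * sr j) := by
  simp only [sr_mul_sr, sr_mul_r, sr.injEq]
  ring

/-- In a connected trivalent Cayley graph of a dihedral group that is neither arc-transitive nor
normal, the connection set consists of reflections, two of which commute. -/
theorem exists_eq_sr (h1 : (1 : DihedralGroup n) ∉ S) (hinv : ∀ s ∈ S, s⁻¹ ∈ S)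
    (hcard : S.ncard = 3) (hconn : (cay S).Connected) (harc : ¬ IsArcTransitive (cay S))
    (hnormal : ¬ IsNormalCayley S) :
    ∃ c i j : ZMod n, S = {sr c, sr i, sr j} ∧ i ≠ j ∧ 2 * (j - i) = 0 := by
  obtain ⟨s, x, y, hS, hsx, hsy, hxy, hr⟩ := exists_isRigid h1 hinv hcard harc
  obtain ⟨hs, σ, v, hv, hsv⟩ := exists_fixesBall h1 hinv hconn hS hsx hsy hxy hr hnormal
  have hsS : s ∈ S := by simp [hS]
  have hxS : x ∈ S := by simp [hS]
  have hyS : y ∈ S := by simp [hS]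
  have hσw : σ (s * v) = s * v := hv.2 s hsS
  have hmoved : ∀ t ∈ S, t ≠ s → σ (t * (s * v)) ≠ t * (s * v) := by
    intro t ht hts h
    refine hsv (fixesBall_of_two h1 hinv hS hσw (p := s) (q := t) hsS ht hts.symm ?_ h)
    rw [hr.map_mul, hσw]
  -- σ moves t s v, but fixes s t' v, which lies in the fixed ball around t' v.
  have hcomm : ∀ t ∈ S, t ≠ s → ∀ t' ∈ S, t' ≠ s → t * s ≠ s * t' := by
    intro t ht hts t' ht' hts' h
    refine hmoved t ht hts ?_
    rw [← mul_assoc, h, mul_assoc]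
    exact (hv.mul h1 hinv hS hr hs ht' hts').2 s hsS
  have hsr : ∃ c, s = sr c := by
    rcases s with k | c
    · refine absurd ?_ (hcomm x hxS hsx.symm x hxS hsx.symm)
      have hk : k = -k := by simpa using hs.symm
      rcases x with l | l
      · simp [add_comm]
      · simp only [sr_mul_r, r_mul_sr, sr.injEq]
        rw [sub_eq_add_neg, ← hk]
    · exact ⟨c, rfl⟩
  obtain ⟨c, rfl⟩ := hsr
  have hall : ∀ t ∈ S, t ≠ sr c → ∃ i, t = sr i := by
    intro t ht hts
    rcases t with k | i
    · refine absurd (r_mul_sr_eq_sr_mul_inv k c) (hcomm _ ht hts _ (hinv _ ht) ?_)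
      simp
    · exact ⟨i, rfl⟩
  obtain ⟨i, rfl⟩ := hall x hxS hsx.symm
  obtain ⟨j, rfl⟩ := hall y hyS hsy.symm
  refine ⟨c, i, j, hS, fun h => hxy (h ▸ rfl), two_mul_sub_eq_zero_of_commute ?_⟩
  set w := sr c * v with hw
  -- `σ` interchanges the two remaining neighbours of `w`
  have hσx : σ (sr i * w) = sr j * w := by
    obtain ⟨t, ht, h⟩ := exists_map_mul_left h1 hinv σ hxS w
    rw [hσw] at h
    have ht' := hS.subset ht
    rcases ht' with rfl | rfl | rfl
    · exact absurd (mul_right_cancel (σ.injective (h.trans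
        (by rw [hr.map_mul, hσw] : σ (sr c * w) = sr c * w).symm))) hsx.symm
    · exact absurd h (hmoved _ hxS hsx.symm)
    · exact h
  have hfix : σ (sr j * (sr i * w)) = sr j * (sr i * w) := by
    have hball := ((hv.mul h1 hinv hS hr hs hyS hsy.symm).mul h1 hinv hS hr hs hxS hsx.symm).2 _ hsS
    have : sr j * (sr i * w) = sr c * (sr i * (sr j * v)) := by
      rw [hw]
      simpa only [mul_assoc] using congrArg (· * v) (sr_mul_sr_mul_sr_comm i j c)
    rw [this, hball]
  -- The fixed vertex y x w is adjacent to σ (x w) = y w, so y x = t y for some t in S; only t = x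
  -- survives.
  obtain ⟨t, ht, h⟩ := exists_map_mul_left h1 hinv σ hyS (sr i * w)
  rw [hfix, hσx] at h
  have h' : sr j * sr i = t * sr j := mul_right_cancel (b := w) (by rwa [mul_assoc, mul_assoc])
  rcases hS.subset ht with rfl | rfl | rfl
  · refine absurd (mul_right_cancel (σ.injective (hfix.trans ?_))) hsy.symm
    rw [hr.map_mul, hσx, h]
  · exact h'
  · exact absurd (mul_left_cancel h') (fun h => hxy h)

end Stabilizer

/-! ### Normalizing the connection set by an automorphism -/

section Normalize

theorem two_mul_natCast_eq_zero (m : ℕ) : (2 : ZMod (2 * m)) * m = 0 := by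
  exact_mod_cast ZMod.natCast_self (2 * m)

/-- Multiplication by m sees only the parity of e. -/
theorem mul_natCast_eq_zero_or_eq {m : ℕ} (e : ZMod (2 * m)) : e * m = 0 ∨ e * m = m := by
  obtain ⟨z, rfl⟩ := ZMod.intCast_surjective e
  have h2 := two_mul_natCast_eq_zero m
  rcases Int.even_or_odd' z with ⟨k, rfl | rfl⟩
  · left; push_cast; linear_combination (k : ZMod (2 * m)) * h2
  · right; push_cast; linear_combination (k : ZMod (2 * m)) * h2

theorem natCast_ne_zero {m : ℕ} (hm : m ≠ 0) : (m : ZMod (2 * m)) ≠ 0 := by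
  intro h
  have := Nat.le_of_dvd (by omega) ((ZMod.natCast_eq_zero_iff m (2 * m)).1 h)
  omega

theorem eq_zero_or_eq_of_two_mul_eq_zero {m : ℕ} {e : ZMod (2 * m)} (h : 2 * e = 0) :
    e = 0 ∨ e = m := by
  obtain ⟨z, rfl⟩ := ZMod.intCast_surjective e
  have h' : ((2 * z : ℤ) : ZMod (2 * m)) = 0 := by exact_mod_cast h
  obtain ⟨k, hk⟩ := (ZMod.intCast_zmod_eq_zero_iff_dvd _ _).1 h'
  have hz : z = k * m := by push_cast at hk; linarith
  rw [hz]
  push_cast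
  exact mul_natCast_eq_zero_or_eq _

theorem even_of_two_mul_eq_zero {n : ℕ} {e : ZMod n} (he : e ≠ 0) (h : 2 * e = 0) : Even n := by
  by_contra hn
  rw [Nat.not_even_iff_odd] at hn
  have h2 : IsUnit ((2 : ℕ) : ZMod n) :=
    (ZMod.isUnit_iff_coprime 2 n).2 ((Nat.coprime_two_left).2 hn)
  exact he (h2.mul_right_eq_zero.1 (by exact_mod_cast h))

/-- If `d` and `m` generate the cyclic group of order `2 * m`, then `d` or `d + m` does. -/
theorem exists_mul_eq_one {m : ℕ} {d k l : ZMod (2 * m)} (h : k * d + l * m = 1) :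
    (∃ k', k' * d = 1) ∨ ∃ k', k' * (d + m) = 1 := by
  have h2 := two_mul_natCast_eq_zero m
  rcases mul_natCast_eq_zero_or_eq l with hl | hl
  · exact Or.inl ⟨k, by linear_combination h - hl⟩
  rcases mul_natCast_eq_zero_or_eq d with hd | hd
  · right
    rcases mul_natCast_eq_zero_or_eq k with hk | hk
    -- Multiplying `h` by m gives m * m = m in this case.
    · refine ⟨k + m, ?_⟩
      linear_combination (h - hl) * (1 + m) + hk + hd * (1 - k)
    · exact ⟨k, by linear_combination h - hl + hk⟩
  · exact Or.inl ⟨k + m, by linear_combination h - hl + hd⟩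

variable {n : ℕ}

theorem exists_combination_eq_one {S : Set (DihedralGroup n)} (h1 : (1 : DihedralGroup n) ∉ S)
    (hinv : ∀ s ∈ S, s⁻¹ ∈ S) (hconn : (cay S).Connected) {c i e : ZMod n}
    (hS : S = {sr c, sr i, sr (i + e)}) : ∃ k l : ZMod n, k * (i - c) + l * e = 1 := by
  -- With I the ideal generated by i - c and e, rotations have index in I and reflections have index
  -- in c + I; left multiplication by S preserves this.
  let P : DihedralGroup n → Prop
    | r x => ∃ k l : ZMod n, k * (i - c) + l * e = x
    | sr x => ∃ k l : ZMod n, k * (i - c) + l * e = x - c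
  refine forall_of_connected h1 hinv hconn (P := P) (g₀ := 1) ⟨0, 0, by simp⟩ ?_ (r 1)
  intro s hs g hg
  rcases hS.subset hs with rfl | rfl | rfl <;> rcases g with x | x <;> obtain ⟨k, l, h⟩ := hg <;>
    simp only [sr_mul_r, sr_mul_sr]
  · exact ⟨k, l, by linear_combination h⟩
  · exact ⟨k, l, by linear_combination h⟩
  · exact ⟨k + 1, l, by linear_combination h⟩
  · exact ⟨k - 1, l, by linear_combination h⟩
  · exact ⟨k + 1, l + 1, by linear_combination h⟩
  · exact ⟨k - 1, l - 1, by linear_combination h⟩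

/-- The automorphism of the dihedral group that sends the rotation of index `x` to the one of index
`u * x` and the reflection of index `x` to the one of index `u * x + t`. -/
def affineAut (u : (ZMod n)ˣ) (t : ZMod n) : MulAut (DihedralGroup n) where
  toFun
    | r x => r ((u : ZMod n) * x)
    | sr x => sr ((u : ZMod n) * x + t)
  invFun
    | r x => r ((u⁻¹ : (ZMod n)ˣ) * x)
    | sr x => sr ((u⁻¹ : (ZMod n)ˣ) * (x - t))
  left_inv := by rintro (x | x) <;> simp
  right_inv := by rintro (x | x) <;> simp
  map_mul' := by
    rintro (x | x) (y | y) <;>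
      simp only [r_mul_r, r_mul_sr, sr_mul_r, sr_mul_sr, r.injEq, sr.injEq] <;> ring

@[simp]
theorem affineAut_sr (u : (ZMod n)ˣ) (t x : ZMod n) : affineAut u t (sr x) = sr ((u : ZMod n) * x + t) := rfl

theorem exists_mulAut_image {m : ℕ} (hm : m ≠ 0) {c i k : ZMod (2 * m)} (hk : k * (i - c) = 1) :
    ∃ α : MulAut (DihedralGroup (2 * m)),
      α '' {sr c, sr i, sr (i + (m : ZMod (2 * m)))} = {sr 0, sr 1, sr (m : ZMod (2 * m))} := by
  have h2 := two_mul_natCast_eq_zero m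
  have hkm : k * m = m := by
    refine (mul_natCast_eq_zero_or_eq k).resolve_left fun h => natCast_ne_zero hm ?_
    linear_combination (i - c) * h - m * hk
  -- The map x ↦ k (i - x) sends i to 0, c to 1 and i + m to -k m = m.
  let u : (ZMod (2 * m))ˣ := ⟨-k, -(i - c), by linear_combination hk, by linear_combination hk⟩
  refine ⟨affineAut u (k * i), ?_⟩
  rw [Set.image_insert_eq, Set.image_pair, affineAut_sr, affineAut_sr, affineAut_sr,
    show (u : ZMod (2 * m)) = -k from rfl, show -k * c + k * i = 1 by linear_combination hk,
    show -k * i + k * i = 0 by ring,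
    show -k * (i + m) + k * i = (m : ZMod (2 * m)) by linear_combination -hkm - h2,
    Set.insert_comm]

end Normalize

/-! ### Identification with the cross ladder graph -/

section CrossLadder

/-- An isomorphism of groups carrying `S` to `T` is an isomorphism of the Cayley graphs. -/
def cayIsoOfImage {G : Type*} [Group G] {S T : Set G} (α : MulAut G) (h : α '' S = T) :
    cay S ≃g cay T where
  toEquiv := α.toEquiv
  map_rel_iff' := by
    subst h
    intro x y
    simp [cay, ← map_mul]

variable {m : ℕ}

theorem two_mul_ne_two_mul_sub_one (hm : m ≠ 0) (x y : ZMod (2 * m)) : 2 * x ≠ 2 * y - 1 := by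
  intro h
  have h2 := two_mul_natCast_eq_zero m
  exact natCast_ne_zero hm (by linear_combination (y - x) * h2 + m * h)

theorem two_mul_eq_two_mul_iff {x y : ZMod (2 * m)} :
    2 * x = 2 * y ↔ y = x ∨ y = x + m := by
  have h2 := two_mul_natCast_eq_zero m
  constructor
  · intro h
    rcases eq_zero_or_eq_of_two_mul_eq_zero (e := y - x) (by linear_combination -h) with h | h
    · exact Or.inl (by linear_combination h)
    · exact Or.inr (by linear_combination h)
  · rintro (rfl | rfl)
    · rfl
    · linear_combination -h2

theorem crossLadder_adj {p q : ZMod (2 * m) × ZMod 2} (hpq : p ≠ q) :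
    (crossLadder m).Adj p q ↔
      ((∃ (i : ZMod (2 * m)) (r : ZMod 2), s(p, q) = s((2 * i, r), (2 * i + 1, r))) ∨
      ∃ (i : ZMod (2 * m)) (r s : ZMod 2), s(p, q) = s((2 * i + 1, r), (2 * i + 2, s))) := by
  simp [crossLadder, hpq]

theorem not_crossLadder_adj_even (hm : m ≠ 0) (x y : ZMod (2 * m)) (r s : ZMod 2) :
    ¬ (crossLadder m).Adj (2 * x, r) (2 * y, s) := by
  intro h
  have key := two_mul_ne_two_mul_sub_one hm
  rcases (crossLadder_adj h.ne).1 h with ⟨i, t, h⟩ | ⟨i, t, u, h⟩ <;>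
    simp only [Sym2.eq_iff, Prod.mk.injEq] at h <;> rcases h with ⟨⟨h, -⟩, h', -⟩ | ⟨⟨h, -⟩, h', -⟩
  · exact key y (i + 1) (by linear_combination h')
  · exact key x (i + 1) (by linear_combination h)
  · exact key x (i + 1) (by linear_combination h)
  · exact key y (i + 1) (by linear_combination h')

theorem not_crossLadder_adj_odd (hm : m ≠ 0) (x y : ZMod (2 * m)) (r s : ZMod 2) :
    ¬ (crossLadder m).Adj (2 * x - 1, r) (2 * y - 1, s) := by
  intro h
  have key := two_mul_ne_two_mul_sub_one hm
  rcases (crossLadder_adj h.ne).1 h with ⟨i, t, h⟩ | ⟨i, t, u, h⟩ <;>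
    simp only [Sym2.eq_iff, Prod.mk.injEq] at h <;> rcases h with ⟨⟨h, -⟩, h', -⟩ | ⟨⟨h, -⟩, h', -⟩
  · exact key i x (by linear_combination -h)
  · exact key i y (by linear_combination -h')
  · exact key (i + 1) y (by linear_combination -h')
  · exact key (i + 1) x (by linear_combination -h)

theorem crossLadder_adj_even_odd (hm : m ≠ 0) (x y : ZMod (2 * m)) (r s : ZMod 2) :
    (crossLadder m).Adj (2 * x, r) (2 * y - 1, s) ↔
      2 * x = 2 * y ∨ 2 * (x + 1) = 2 * y ∧ r = s := by
  have key := two_mul_ne_two_mul_sub_one hm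
  rw [crossLadder_adj (fun h => key x y (congrArg Prod.fst h))]
  simp only [Sym2.eq_iff, Prod.mk.injEq]
  constructor
  · rintro (⟨i, t, ⟨⟨h, rfl⟩, h', rfl⟩ | ⟨⟨h, rfl⟩, h', rfl⟩⟩ |
      ⟨i, t, u, ⟨⟨h, rfl⟩, h', rfl⟩ | ⟨⟨h, rfl⟩, h', rfl⟩⟩)
    · exact Or.inr ⟨by linear_combination h - h', rfl⟩
    · exact absurd (show 2 * x = 2 * (i + 1) - 1 by linear_combination h) (key _ _)
    · exact absurd (show 2 * x = 2 * (i + 1) - 1 by linear_combination h) (key _ _)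
    · exact Or.inl (by linear_combination h - h')
  · rintro (h | ⟨h, rfl⟩)
    · exact Or.inr ⟨x - 1, s, r, Or.inr ⟨⟨by ring, rfl⟩, by linear_combination -h, rfl⟩⟩
    · exact Or.inl ⟨x, r, Or.inl ⟨⟨rfl, rfl⟩, by linear_combination -h, rfl⟩⟩

/-- The indicator of the upper half of the residues modulo `2 * m`. -/
def upperHalf (x : ZMod (2 * m)) : ZMod 2 := if x.val < m then 0 else 1

theorem upperHalf_add_natCast (hm : m ≠ 0) (x : ZMod (2 * m)) :
    upperHalf (x + (m : ZMod (2 * m))) = upperHalf x + 1 := by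
  have : NeZero (2 * m) := ⟨by omega⟩
  have hx := x.val_lt
  have hmval : (m : ZMod (2 * m)).val = m := ZMod.val_cast_of_lt (by omega)
  unfold upperHalf
  rw [ZMod.val_add, hmval]
  by_cases h : x.val < m
  · rw [Nat.mod_eq_of_lt (by omega), if_neg (by omega), if_pos h, zero_add]
  · rw [Nat.mod_eq_sub_mod (by omega), Nat.mod_eq_of_lt (by omega), if_pos (by omega), if_neg h]
    rfl

theorem eq_of_two_mul_eq_of_upperHalf_eq (hm : m ≠ 0) {x y : ZMod (2 * m)} (h : 2 * x = 2 * y)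
    (h' : upperHalf x = upperHalf y) : x = y := by
  rcases (two_mul_eq_two_mul_iff).1 h with rfl | rfl
  · rfl
  · rw [upperHalf_add_natCast hm, left_eq_add] at h'
    exact absurd h' one_ne_zero

/-- The vertex of the cross ladder graph attached to an element of the dihedral group. -/
def toLadder : DihedralGroup (2 * m) → ZMod (2 * m) × ZMod 2
  -- Doubling identifies x with x + m, and `upperHalf` separates them. The shift to x - 1 for
  -- reflections gives r x and sr (x + 1) the same superscript, while sr x and sr (x + m) fill the
  -- column 2 x - 1.
  | r x => (2 * x, upperHalf x)
  | sr x => (2 * x - 1, upperHalf (x - 1))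

theorem toLadder_injective (hm : m ≠ 0) : Function.Injective (toLadder (m := m)) := by
  have key := two_mul_ne_two_mul_sub_one hm
  rintro (x | x) (y | y) h <;> simp only [toLadder, Prod.mk.injEq] at h <;> obtain ⟨h, h'⟩ := h
  · rw [eq_of_two_mul_eq_of_upperHalf_eq hm h h']
  · exact absurd h (key x y)
  · exact absurd h.symm (key y x)
  · rw [sub_left_injective (eq_of_two_mul_eq_of_upperHalf_eq hm (by linear_combination h) h')]

theorem toLadder_bijective (hm : m ≠ 0) : Function.Bijective (toLadder (m := m)) := by
  have : NeZero (2 * m) := ⟨by omega⟩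
  refine (Fintype.bijective_iff_injective_and_card _).2 ⟨toLadder_injective hm, ?_⟩
  rw [DihedralGroup.card, Fintype.card_prod, ZMod.card, ZMod.card]
  ring

theorem toLadder_adj_r_sr (hm : m ≠ 0) (x y : ZMod (2 * m)) :
    (crossLadder m).Adj (toLadder (r x)) (toLadder (sr y)) ↔ y = x ∨ y = x + 1 ∨ y = x + m := by
  rw [toLadder, toLadder, crossLadder_adj_even_odd hm, two_mul_eq_two_mul_iff]
  have : (2 * (x + 1) = 2 * y ∧ upperHalf x = upperHalf (y - 1)) ↔ y = x + 1 := by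
    constructor
    · rintro ⟨h, h'⟩
      linear_combination -eq_of_two_mul_eq_of_upperHalf_eq hm
        (show 2 * x = 2 * (y - 1) by linear_combination h) h'
    · rintro rfl
      simp
  rw [this]
  tauto

theorem cay_adj_r_sr (x y : ZMod (2 * m)) :
    (cay {sr 0, sr 1, sr (m : ZMod (2 * m))}).Adj (r x) (sr y) ↔
      y = x ∨ y = x + 1 ∨ y = x + m := by
  simp [cay, add_comm]
  rintro (rfl | rfl | rfl) <;> simp

theorem not_cay_adj_r_r (x y : ZMod (2 * m)) :
    ¬ (cay {sr 0, sr 1, sr (m : ZMod (2 * m))}).Adj (r x) (r y) := by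
  simp [cay]

theorem not_cay_adj_sr_sr (x y : ZMod (2 * m)) :
    ¬ (cay {sr 0, sr 1, sr (m : ZMod (2 * m))}).Adj (sr x) (sr y) := by
  simp [cay]

/-- The Cayley graph of the dihedral group of order `4 * m` with respect to `{b, b * a, b * a ^ m}`
is the cross ladder graph. -/
noncomputable def cayIsoCrossLadder (hm : m ≠ 0) :
    cay {sr 0, sr 1, sr (m : ZMod (2 * m))} ≃g crossLadder m where
  toEquiv := Equiv.ofBijective toLadder (toLadder_bijective hm)
  map_rel_iff' := by
    rintro (x | x) (y | y) <;> simp only [Equiv.ofBijective_apply]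
    · exact iff_of_false (not_crossLadder_adj_even hm _ _ _ _) (not_cay_adj_r_r x y)
    · rw [toLadder_adj_r_sr hm, cay_adj_r_sr]
    · rw [SimpleGraph.adj_comm, toLadder_adj_r_sr hm, SimpleGraph.adj_comm, cay_adj_r_sr]
    · exact iff_of_false (not_crossLadder_adj_odd hm _ _ _ _) (not_cay_adj_sr_sr x y)

end CrossLadder

end Dihedrant

open Dihedrant DihedralGroup in
theorem theorem1p1 (n : ℕ) (hn : 3 ≤ n) (S : Set (DihedralGroup n))
    (hS_one : (1 : DihedralGroup n) ∉ S) (hS_inv : ∀ s ∈ S, s⁻¹ ∈ S)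
    (hconn : (Dihedrant.cay S).Connected)
    (htri : Dihedrant.IsTrivalent (Dihedrant.cay S))
    (harc : ¬ Dihedrant.IsArcTransitive (Dihedrant.cay S))
    (hnormal : ¬ Dihedrant.IsNormalCayley S) :
    Even n ∧
      Nonempty (Dihedrant.cay S ≃g Dihedrant.crossLadder (n / 2)) ∧
      ∃ α : MulAut (DihedralGroup n),
        α '' S = {Dihedrant.b n, Dihedrant.b n * Dihedrant.a n,
          Dihedrant.b n * Dihedrant.a n ^ (n / 2)} := by
  have hcard : S.ncard = 3 := by
    have h : (cay S).neighborSet 1 = S := by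
      ext g
      simp [cay_adj_iff hS_one hS_inv]
    rw [← h]
    exact htri 1
  obtain ⟨c, i, j, hS, hij, h2⟩ := exists_eq_sr hS_one hS_inv hcard hconn harc hnormal
  have hij' : j - i ≠ 0 := sub_ne_zero.2 hij.symm
  obtain ⟨m, rfl⟩ := (even_of_two_mul_eq_zero hij' h2).two_dvd
  have hm : m ≠ 0 := by omega
  have hji : j = i + m := by
    linear_combination (eq_zero_or_eq_of_two_mul_eq_zero h2).resolve_left hij'
  subst hji
  have hα : ∃ α : MulAut (DihedralGroup (2 * m)),
      α '' S = {sr 0, sr 1, sr (m : ZMod (2 * m))} := by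
    obtain ⟨k, l, h⟩ := exists_combination_eq_one hS_one hS_inv hconn hS
    rw [hS]
    rcases exists_mul_eq_one h with ⟨k', hk'⟩ | ⟨k', hk'⟩
    · exact exists_mulAut_image hm hk'
    -- Here i and i + m exchange roles, which leaves S unchanged.
    · have := exists_mulAut_image hm (c := c) (i := i + m) (k := k') (by linear_combination hk')
      rwa [show i + (m : ZMod (2 * m)) + m = i by
        linear_combination two_mul_natCast_eq_zero m, Set.pair_comm] at this
  obtain ⟨α, hα⟩ := hα
  rw [Nat.mul_div_cancel_left m two_pos]
  refine ⟨even_two_mul m, ⟨(cayIsoOfImage α hα).trans (cayIsoCrossLadder hm)⟩, α, ?_⟩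
  rw [hα]
  simp [a, b]
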